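/- Let $n\ge 1$, let $e_1,\dots,e_{n+1}$ be the standard basis of Euclidean $\mathbb R^{n+1}$, and let $\mathcal H=\{x\in\mathbb R^{n+1}:\sum_i x_i=0\}$ with the induced inner product $\langle\cdot,\cdot\rangle$ and $n$-dimensional Lebesgue measure $dx$. Let $\alpha_i=e_i-e_{i+1}$ ($1\le i\le n$) be the simple roots of $A_n$, let $\omega_1,\dots,\omega_n\in\mathcal H$ be the fundamental weights, defined by $\langle\alpha_i,\omega_j\rangle=\delta_{ij}$, and put $$P^+=\bigoplus_{i=1}^n\mathbb Z_{\ge0}\,\omega_i,\qquad P^{++}=\Big\{\sum_{i=1}^n c_i\omega_i : c_i\in\mathbb Z_{>0}\Big\}.$$ Let $W=W(A_n)\cong S_{n+1}$ be the Weyl group of $A_n$, acting on $\mathcal H$ by permuting the coordinates; let $F$ be the fundamental domain of the affine Weyl group of $A_n$, namely the simplex with vertices $0,\omega_1,\dots,\omega_n$, let $|F|$ be its volume, and let $\widetilde F=\bigcup_{w\in W}wF$. Let $\chi_1,\dots,\chi_{n_\chi}$ be the distinct irreducible complex characters of $S_{n+1}$, $d_k=\chi_k(\mathrm{id})$, and define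 $$\operatorname{Imm}^{n+1,k}(\lambda,x)=\sum_{w\in W}\chi_k(w)\,e^{2\pi \mathrm i\langle w\lambda,x\rangle}\qquad(\lambda,x\in\mathcal H).$$ Then for all nonzero $\lambda,\mu\in P^+$ and all $k,l\in\{1,\dots,n_\chi\}$, $$\int_{\widetilde F}\operatorname{Imm}^{n+1,k}(\lambda,x)\,\overline{\operatorname{Imm}^{n+1,l}(\mu,x)}\,dx=|W|^2\,|F|\,\delta_{\lambda\mu}\,\delta_{kl}\,\frac1{d_k}\sum_{w\in\operatorname{stab}_W(\lambda)}\chi_k(w).$$ In particular, for all $\lambda,\mu\in P^{++}$ and all $k,l\in\{1,\dots,n_\chi\}$, $$\int_{\widetilde F}\operatorname{Imm}^{n+1,k}(\lambda,x)\,\overline{\operatorname{Imm}^{n+1,l}(\mu,x)}\,dx=|F|\,|W|^2\,\delta_{kl}\,\delta_{\lambda\mu}.$$ -/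

import Mathlib

namespace WeylA

noncomputable section

/-- The hyperplane `x₁ + ⋯ + xₙ₊₁ = 0` of Euclidean `ℝⁿ⁺¹`, with the induced inner product. -/
def H (n : ℕ) : Submodule ℝ (EuclideanSpace ℝ (Fin (n + 1))) where
  carrier := {x | ∑ i, x i = 0}
  zero_mem' := by simp
  add_mem' := by
    intro x y hx hy
    simp only [Set.mem_ofPred_eq] at hx hy
    simp [Finset.sum_add_distrib, hx, hy]
  smul_mem' := by
    intro c x hx
    simp only [Set.mem_ofPred_eq] at hx
    simp [← Finset.mul_sum, hx]

/-- Lebesgue measure of the `n`-dimensional Euclidean space `H n`: the Haar measure giving mass `1`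
to the cube spanned by an orthonormal basis. (The instance `volume` on a subtype would be the
restriction of the measure of `ℝⁿ⁺¹`, for which `H n` is a null set.) -/
def leb (n : ℕ) : MeasureTheory.Measure (H n) :=
  (stdOrthonormalBasis ℝ (H n)).toBasis.addHaar

/-- The Weyl group of `Aₙ`, as the group of permutations of the `n + 1` coordinates. -/
abbrev W (n : ℕ) : Type := Equiv.Perm (Fin (n + 1))

/-- `W n` acts on `H n` by permuting coordinates: `w` moves the `i`-th coordinate to place `w i`. -/
instance instMulAction (n : ℕ) : MulAction (W n) (H n) where
  smul w x := ⟨WithLp.toLp 2 fun i => x.1 (w⁻¹ i), by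
    change ∑ i, x.1 (w⁻¹ i) = 0
    rw [Equiv.sum_comp w⁻¹ fun i => x.1 i]
    exact x.2⟩
  one_smul _ := rfl
  mul_smul _ _ _ := rfl

theorem smul_apply {n : ℕ} (w : W n) (x : H n) (i : Fin (n + 1)) :
    (w • x).1 i = x.1 (w⁻¹ i) := rfl

/-- The simple roots `αᵢ = eᵢ - eᵢ₊₁`. -/
def root (n : ℕ) (i : Fin n) : H n :=
  ⟨EuclideanSpace.single i.castSucc 1 - EuclideanSpace.single i.succ 1, by
    change ∑ j, _ = (0 : ℝ)
    simp [Finset.sum_sub_distrib]⟩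

/-- The fundamental weights, the basis of `H n` dual to the simple roots (`inner_root_weight`):
`e₁ + ⋯ + eᵢ - (i / (n + 1)) (e₁ + ⋯ + eₙ₊₁)`, where the index `i : Fin n` counts from `0`. -/
def weight (n : ℕ) (i : Fin n) : H n :=
  ⟨WithLp.toLp 2 fun j => (if j ≤ i.castSucc then 1 else 0) - ((i : ℝ) + 1) / ((n : ℝ) + 1), by
    change ∑ j : Fin (n + 1), ((if j ≤ i.castSucc then (1 : ℝ) else 0) - _) = 0
    have h : (n : ℝ) + 1 ≠ 0 := by positivity
    have hc : (Finset.univ.filter fun j : Fin (n + 1) => j ≤ i.castSucc) =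
        Finset.Iic i.castSucc := by ext; simp
    rw [Finset.sum_sub_distrib, Finset.sum_boole, hc, Fin.card_Iic]
    simp
    field_simp
    simp⟩

theorem inner_root {n : ℕ} (i : Fin n) (x : H n) :
    inner ℝ (root n i) x = x.1 i.castSucc - x.1 i.succ := by
  rw [Submodule.coe_inner]
  simp [root, inner_sub_left, EuclideanSpace.inner_single_left]

theorem inner_root_weight {n : ℕ} (i j : Fin n) :
    inner ℝ (root n i) (weight n j) = if i = j then (1 : ℝ) else 0 := by
  rw [inner_root]
  simp only [weight, Fin.le_def, Fin.val_castSucc, Fin.val_succ, Fin.ext_iff]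
  split_ifs <;> first | omega | ring

/-- The adjacent transposition `(i i+1)` acts as the reflection `rᵢ` in the hyperplane orthogonal
to `αᵢ`. -/
theorem swap_smul {n : ℕ} (i : Fin n) (x : H n) :
    (Equiv.swap i.castSucc i.succ : W n) • x = x - (inner ℝ (root n i) x : ℝ) • root n i := by
  ext j
  rw [smul_apply, inner_root]
  have hne : i.castSucc ≠ i.succ := (Fin.castSucc_lt_succ).ne
  by_cases h1 : j = i.castSucc
  · subst h1
    simp [root, hne]
  · by_cases h2 : j = i.succ
    · subst h2
      simp [root, hne.symm]
    · simp [root, Equiv.swap_apply_of_ne_of_ne h1 h2, h1, h2]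

/-- Dominant weights `P⁺`. -/
def dominant (n : ℕ) : Set (H n) :=
  {l | ∃ c : Fin n → ℕ, l = ∑ i, c i • weight n i}

/-- Strictly dominant weights `P⁺⁺`. -/
def strictlyDominant (n : ℕ) : Set (H n) :=
  {l | ∃ c : Fin n → ℕ, (∀ i, 0 < c i) ∧ l = ∑ i, c i • weight n i}

/-- The fundamental domain of the affine Weyl group: the simplex with vertices `0, ω₁, …, ωₙ`. -/
def F (n : ℕ) : Set (H n) :=
  convexHull ℝ (insert 0 (Set.range (weight n)))

/-- The union of the images of `F n` under the Weyl group. -/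
def Ftilde (n : ℕ) : Set (H n) :=
  ⋃ w : W n, (fun x => w • x) '' F n

/-- `χ` is the character of an irreducible finite-dimensional complex representation of `G`. -/
def IsIrredChar {G : Type} [Group G] (χ : G → ℂ) : Prop :=
  ∃ (V : Type) (_ : AddCommGroup V) (_ : Module ℂ V) (_ : FiniteDimensional ℂ V)
    (ρ : Representation ℂ G V), ρ.IsIrreducible ∧ ρ.character = χ

/-- The immanant function attached to `χ`. -/
def Imm {n : ℕ} (χ : W n → ℂ) (l x : H n) : ℂ :=
  ∑ w : W n, χ w * Complex.exp (2 * Real.pi * Complex.I * ((inner ℝ (w • l) x : ℝ) : ℂ))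

open Classical in
/-- The stabilizer of `l` in the Weyl group. -/
def stab {n : ℕ} (l : H n) : Finset (W n) := {w | w • l = l}

open Classical in
/-- Kronecker delta. -/
def delta {α : Type} (a b : α) : ℂ := if a = b then 1 else 0

end

end WeylA

/-! Expanding both immanants turns the integrand into a double sum over `w`, `v` of `χ w * conj (ψ
v)` times the exponential with frequency `w • λ - v • μ`. These exponentials are periodic under the
root lattice, and `Ftilde n` is a fundamental domain for it (`isAddFundamentalDomain_Ftilde`), so
only the pairs with `w • λ = v • μ` survive (`IsWeight.setIntegral_expInner`).

A Weyl orbit meets the dominant weights at most once (`eq_of_smul_eq_smul`). Hence survivors need `λ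
= μ`, and then `w = v * s` with `s` in the stabilizer. Schur's lemma evaluates the sum over `v` of
`χ (v * s) * conj (ψ v)` as `|W| δ χ(s) / χ(1)` (`IsIrredChar.sum_mul_conj`). The second factor
`|W|` is the number of copies of `F n` that tile `Ftilde n` (`leb_real_Ftilde`). -/

namespace WeylA

/-! ### Twisted orthogonality of irreducible characters -/

section Characters

open Representation Module

variable {G V U : Type*} [Group G]
  [AddCommGroup V] [Module ℂ V] [FiniteDimensional ℂ V]
  [AddCommGroup U] [Module ℂ U] [FiniteDimensional ℂ U]

open scoped ComplexOrder Matrix in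
/-- The trace of an invertible element of a finite group of matrices is conjugate to the trace of
its inverse. -/
theorem star_trace_eq_trace_inv [Fintype G] {m : Type*} [Fintype m] [DecidableEq m]
    (A : G →* Matrix m m ℂ) (g : G) : star (A g).trace = (A g⁻¹).trace := by
  classical
  -- Averaging the standard Hermitian form over the group gives an invariant positive definite form;
  -- every `A g` is unitary for it.
  set M : Matrix m m ℂ := ∑ h, (A h)ᴴ * A h with hM
  have hpos : M.PosDef := by
    rw [hM, ← Finset.add_sum_erase _ _ (Finset.mem_univ (1 : G))]
    refine Matrix.PosDef.add_posSemidef ?_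
      (Matrix.posSemidef_sum _ fun h _ => Matrix.posSemidef_conjTranspose_mul_self _)
    simpa using Matrix.PosDef.one
  have hinv : (A g)ᴴ * M * A g = M := by
    rw [hM, Finset.mul_sum, Finset.sum_mul]
    refine Fintype.sum_equiv (Equiv.mulRight g) _ _ fun h => ?_
    simp [Matrix.conjTranspose_mul, Matrix.mul_assoc]
  have hA : A g * A g⁻¹ = 1 := by rw [← map_mul]; simp
  have hdet : IsUnit M.det := (Matrix.isUnit_iff_isUnit_det _).1 hpos.isUnit
  have key : (A g)ᴴ = M * A g⁻¹ * M⁻¹ := by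
    calc (A g)ᴴ = (A g)ᴴ * M * (A g * A g⁻¹) * M⁻¹ := by
          rw [hA, Matrix.mul_one, Matrix.mul_nonsing_inv_cancel_right _ _ hdet]
      _ = ((A g)ᴴ * M * A g) * A g⁻¹ * M⁻¹ := by simp only [Matrix.mul_assoc]
      _ = M * A g⁻¹ * M⁻¹ := by rw [hinv]
  rw [← Matrix.trace_conjTranspose, key, Matrix.trace_mul_comm, ← Matrix.mul_assoc,
    Matrix.nonsing_inv_mul _ hdet, Matrix.one_mul]

theorem star_character [Fintype G] (ρ : Representation ℂ G V) (g : G) :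
    star (ρ.character g) = ρ.character g⁻¹ := by
  let b := finBasis ℂ V
  have h : ∀ g, ρ.character g = (LinearMap.toMatrix b b (ρ g)).trace := fun g =>
    LinearMap.trace_eq_matrix_trace ℂ b (ρ g)
  rw [h, h]
  exact star_trace_eq_trace_inv
    ((LinearMap.toMatrixAlgEquiv b).toAlgHom.toRingHom.toMonoidHom.comp ρ) g

theorem finrank_ne_zero_of_isIrreducible (ρ : Representation ℂ G V) [ρ.IsIrreducible] :
    finrank ℂ V ≠ 0 := by
  intro h
  have hs : Subsingleton V := finrank_zero_iff.1 h
  -- By Schur's lemma the endomorphism algebra has dimension one, whereas that of the zero space has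
  -- dimension zero.
  have h1 := IsIrreducible.finrank_intertwiningMap_self ρ
  have : Subsingleton (IntertwiningMap ρ ρ) :=
    ⟨fun f g => by ext x; exact Subsingleton.elim _ _⟩
  rw [finrank_zero_of_subsingleton] at h1
  exact zero_ne_one h1

theorem sum_character_mul_character_inv [Fintype G] [DecidableEq (G → ℂ)]
    (ρ : Representation ℂ G V) (σ : Representation ℂ G U)
    [ρ.IsIrreducible] [σ.IsIrreducible] :
    ∑ g, ρ.character g * σ.character g⁻¹ =
      if ρ.character = σ.character then (Fintype.card G : ℂ) else 0 := by
  classical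
  have hc : (Nat.card G : ℂ) ≠ 0 := by exact_mod_cast Nat.card_pos.ne'
  have : Invertible (Nat.card G : ℂ) := invertibleOfNonzero hc
  have h := char_orthonormal ρ σ
  have h' := char_orthonormal ρ ρ
  rw [if_pos ⟨Representation.Equiv.refl _⟩] at h'
  rw [inv_mul_eq_iff_eq_mul₀ hc] at h h'
  rw [h, ← Nat.card_eq_fintype_card]
  by_cases he : Nonempty (Representation.Equiv σ ρ)
  · rw [if_pos he, if_pos (char_iso he.some).symm, mul_one]
  · rw [if_neg he, mul_zero, if_neg]
    -- Non-isomorphic representations with equal characters would make the same sum both `0` and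
    -- `|G|`.
    intro hχ
    rw [if_neg he, mul_zero, ← hχ, h', mul_one] at h
    exact hc h

/-- The element `∑ v, σ(v⁻¹) ρ(v)` of the group algebra acts on `ρ` by an intertwining map. -/
noncomputable def characterAverage [Fintype G] (ρ : Representation ℂ G V) (σ : Representation ℂ G U) :
    IntertwiningMap ρ ρ where
  toLinearMap := ∑ v, σ.character v⁻¹ • ρ v
  isIntertwining' g := by
    ext x
    simp only [LinearMap.comp_apply, LinearMap.sum_apply, LinearMap.smul_apply, map_sum, map_smul]
    refine Fintype.sum_equiv (MulAut.conj g⁻¹).toEquiv _ _ fun v => ?_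
    simp [← Module.End.mul_apply, ← map_mul, mul_assoc, ← char_conj σ v⁻¹ g⁻¹]

/-- By Schur's lemma `characterAverage ρ σ` is a scalar `c`. Taking the trace against `ρ s` gives `c
* ρ.character s`, and ordinary orthogonality at `s = 1` determines `c`. -/
theorem sum_character_mul_mul_character_inv [Fintype G] [DecidableEq (G → ℂ)]
    (ρ : Representation ℂ G V) (σ : Representation ℂ G U)
    [ρ.IsIrreducible] [σ.IsIrreducible] (s : G) :
    ∑ g, ρ.character (g * s) * σ.character g⁻¹ =
      if ρ.character = σ.character then (Fintype.card G : ℂ) * (1 / ρ.character 1) * ρ.character s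
      else 0 := by
  obtain ⟨c, hc⟩ := (IsIrreducible.algebraMap_intertwiningMap_bijective_of_isAlgClosed
    (ρ := ρ)).2 (characterAverage ρ σ)
  have hT : ∑ v, σ.character v⁻¹ • ρ v = c • LinearMap.id := by
    have := congrArg IntertwiningMap.toLinearMap hc
    exact this.symm
  have htr : ∀ s, ∑ g, ρ.character (g * s) * σ.character g⁻¹ = c * ρ.character s := by
    intro s
    have := congrArg (fun T => LinearMap.trace ℂ V (T * ρ s)) hT
    simp only [Finset.sum_mul, map_sum, smul_mul_assoc, map_smul, smul_eq_mul, ← map_mul] at this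
    rw [← Module.End.one_eq_id, one_mul] at this
    rw [character, ← this]
    exact Finset.sum_congr rfl fun g _ => mul_comm _ _
  have h1 := htr 1
  simp only [mul_one] at h1
  rw [sum_character_mul_character_inv] at h1
  have hd : ρ.character 1 ≠ 0 := by
    rw [char_one]; exact_mod_cast finrank_ne_zero_of_isIrreducible ρ
  rw [htr]
  split_ifs at h1 ⊢ with h
  · rw [h1]; field_simp
  · rw [(mul_eq_zero.1 h1.symm).resolve_right hd, zero_mul]

theorem IsIrredChar.apply_one_ne_zero {G : Type} [Group G] {χ : G → ℂ}
    (hχ : IsIrredChar χ) : χ 1 ≠ 0 := by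
  obtain ⟨V, _, _, _, ρ, hρ, rfl⟩ := hχ
  rw [char_one]
  exact_mod_cast finrank_ne_zero_of_isIrreducible ρ

/-- Orthogonality of the irreducible characters, twisted by a group element. -/
theorem IsIrredChar.sum_mul_conj {G : Type} [Group G] [Fintype G] {χ ψ : G → ℂ}
    (hχ : IsIrredChar χ) (hψ : IsIrredChar ψ) (s : G) :
    ∑ g, χ (g * s) * (starRingEnd ℂ) (ψ g) =
      (Fintype.card G : ℂ) * delta χ ψ * (1 / χ 1) * χ s := by
  classical
  obtain ⟨V, _, _, _, ρ, hρ, rfl⟩ := hχ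
  obtain ⟨U, _, _, _, σ, hσ, rfl⟩ := hψ
  have h := sum_character_mul_mul_character_inv ρ σ s
  simp only [← star_character] at h
  simp only [starRingEnd_apply, h, delta]
  split_ifs <;> simp

end Characters

end WeylA

namespace WeylA

/-! ### The simplex, its Weyl images and their volumes -/

section Geometry

open MeasureTheory Module

variable {n : ℕ}

theorem H_ext {x y : H n} (h : ∀ i, x.1 i = y.1 i) : x = y :=
  Subtype.ext (PiLp.ext h)

theorem sum_coord (x : H n) : ∑ i, x.1 i = 0 := x.2

theorem coord_add (x y : H n) (i : Fin (n + 1)) : (x + y).1 i = x.1 i + y.1 i := rfl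

theorem coord_sub (x y : H n) (i : Fin (n + 1)) : (x - y).1 i = x.1 i - y.1 i := rfl

theorem coord_neg (x : H n) (i : Fin (n + 1)) : (-x).1 i = -x.1 i := rfl

theorem coord_smul (c : ℝ) (x : H n) (i : Fin (n + 1)) : (c • x).1 i = c * x.1 i := rfl

theorem inner_eq_sum (x y : H n) : inner ℝ x y = ∑ i, x.1 i * y.1 i := by
  rw [Submodule.coe_inner, PiLp.inner_apply]
  exact Finset.sum_congr rfl fun i _ => by simp [mul_comm]

/-- A point of `H n` is determined by its inner products with the simple roots. -/
theorem eq_of_sub_succ_eq {x y : H n}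
    (h : ∀ i : Fin n, x.1 i.castSucc - x.1 i.succ = y.1 i.castSucc - y.1 i.succ) : x = y := by
  have hz : ∀ j, x.1 j - y.1 j = x.1 0 - y.1 0 := by
    intro j
    induction j using Fin.induction with
    | zero => rfl
    | succ i ih => linarith [h i]
  have hs : ∑ j, (x.1 j - y.1 j) = 0 := by
    rw [Finset.sum_sub_distrib, sum_coord, sum_coord, sub_zero]
  simp only [hz, Finset.sum_const, Finset.card_univ, Fintype.card_fin, nsmul_eq_mul] at hs
  have h0 : x.1 0 - y.1 0 = 0 :=
    (mul_eq_zero.1 hs).resolve_left (by exact_mod_cast n.succ_ne_zero)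
  exact H_ext fun j => by linarith [hz j]

theorem sub_succ_sum_smul_weight (c : Fin n → ℝ) (i : Fin n) :
    (∑ j, c j • weight n j).1 i.castSucc - (∑ j, c j • weight n j).1 i.succ = c i := by
  rw [← inner_root, inner_sum]
  have h : ∀ j, inner ℝ (root n i) (c j • weight n j) = if i = j then c j else 0 := fun j => by
    refine (real_inner_smul_right (root n i) (weight n j) (c j)).trans ?_
    rw [inner_root_weight, mul_ite, mul_one, mul_zero]
  rw [Finset.sum_congr rfl fun j _ => h j]
  simp

theorem eq_sum_smul_weight (x : H n) :
    x = ∑ i : Fin n, (x.1 i.castSucc - x.1 i.succ) • weight n i :=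
  eq_of_sub_succ_eq fun i =>
    (sub_succ_sum_smul_weight (fun i : Fin n => x.1 i.castSucc - x.1 i.succ) i).symm

theorem sum_castSucc_sub_succ (f : Fin (n + 1) → ℝ) :
    ∑ i : Fin n, (f i.castSucc - f i.succ) = f 0 - f (Fin.last n) := by
  have h := Fin.sum_univ_succ f
  rw [Fin.sum_univ_castSucc] at h
  rw [Finset.sum_sub_distrib]
  linarith

/-- The consecutive differences of coordinates are the barycentric coordinates at the fundamental
weights; the remaining one, at the vertex `0`, is `1 - (x₀ - xₙ)`. -/
theorem mem_F_iff (x : H n) :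
    x ∈ F n ↔ Antitone (fun i => x.1 i) ∧ x.1 0 - x.1 (Fin.last n) ≤ 1 := by
  constructor
  · intro hx
    have hconv : Convex ℝ {x : H n | Antitone (fun i => x.1 i) ∧
        x.1 0 - x.1 (Fin.last n) ≤ 1} := by
      intro x hx y hy a b ha hb hab
      refine ⟨fun i j hij => ?_, ?_⟩
      · have h1 := mul_le_mul_of_nonneg_left (hx.1 hij) ha
        have h2 := mul_le_mul_of_nonneg_left (hy.1 hij) hb
        simp only [coord_add, coord_smul]
        exact add_le_add h1 h2
      · have h1 := mul_le_mul_of_nonneg_left hx.2 ha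
        have h2 := mul_le_mul_of_nonneg_left hy.2 hb
        simp only [coord_add, coord_smul]
        linarith
    refine convexHull_min ?_ hconv hx
    rintro y (rfl | ⟨j, rfl⟩)
    · exact ⟨fun i j _ => le_rfl, by simp⟩
    · refine ⟨fun i k hik => ?_, ?_⟩
      · simp only [weight]
        split_ifs with h1 h2
        · exact le_rfl
        · exact absurd (hik.trans h1) h2
        · linarith
        · exact le_rfl
      · simp only [weight]
        split_ifs <;> linarith
  · rintro ⟨hanti, hle⟩
    have h := (convex_convexHull ℝ (insert 0 (Set.range (weight n)))).sum_mem
      (t := (Finset.univ : Finset (Option (Fin n))))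
      (w := fun o => o.elim (1 - (x.1 0 - x.1 (Fin.last n)))
        fun i => x.1 i.castSucc - x.1 i.succ)
      (z := fun o => o.elim 0 (weight n)) ?_ ?_ ?_
    · rw [Fintype.sum_option] at h
      simp only [Option.elim_none, Option.elim_some, smul_zero, zero_add] at h
      rwa [← eq_sum_smul_weight] at h
    · rintro (_ | i) _
      · exact sub_nonneg.2 hle
      · exact sub_nonneg.2 (hanti (Fin.castSucc_le_succ i))
    · rw [Fintype.sum_option]
      simp only [Option.elim_none, Option.elim_some, sum_castSucc_sub_succ]
      ring
    · rintro (_ | i) _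
      · exact subset_convexHull ℝ _ (Set.mem_insert _ _)
      · exact subset_convexHull ℝ _ (Set.mem_insert_of_mem _ ⟨i, rfl⟩)

/-- `Ftilde n` is cut out by the inequalities `⟨α, x⟩ ≤ 1`, where `α` ranges over the roots. -/
theorem mem_Ftilde_iff (x : H n) : x ∈ Ftilde n ↔ ∀ i j, x.1 i - x.1 j ≤ 1 := by
  simp only [Ftilde, Set.mem_iUnion, Set.mem_image]
  constructor
  · rintro ⟨w, y, hy, rfl⟩ i j
    rw [mem_F_iff] at hy
    rw [smul_apply, smul_apply]
    have h1 := hy.1 (Fin.zero_le (w⁻¹ i))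
    have h2 := hy.1 (Fin.le_last (w⁻¹ j))
    have h3 := hy.2
    simp only at h1 h2
    linarith
  · intro h
    -- Sorting the negatives puts the coordinates of `x` in decreasing order.
    let σ : W n := Tuple.sort fun i => -x.1 i
    refine ⟨σ, σ⁻¹ • x, (mem_F_iff _).2 ⟨fun i j hij => ?_, ?_⟩, smul_inv_smul _ _⟩
    · have := Tuple.monotone_sort (fun i => -x.1 i) hij
      simp only [Function.comp_apply, neg_le_neg_iff] at this
      simpa only [smul_apply, inv_inv] using this
    · simp only [smul_apply]
      exact h _ _

/-- The action of a permutation as a linear isometry. -/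
noncomputable def permIsometry (w : W n) : H n ≃ₗᵢ[ℝ] H n where
  toFun x := w • x
  invFun x := w⁻¹ • x
  map_add' _ _ := rfl
  map_smul' _ _ := rfl
  left_inv := inv_smul_smul w
  right_inv := smul_inv_smul w
  norm_map' x := by
    change ‖w • x‖ = ‖x‖
    rw [← sq_eq_sq₀ (norm_nonneg _) (norm_nonneg _), ← real_inner_self_eq_norm_sq,
      ← real_inner_self_eq_norm_sq, inner_eq_sum, inner_eq_sum]
    exact Equiv.sum_comp w⁻¹ fun i => x.1 i * x.1 i

instance : (leb n).IsAddHaarMeasure := by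
  unfold leb; infer_instance

/-- A linear map scales Haar measure by a constant, and an isometry preserves the unit ball, so this
constant is `1`. -/
theorem leb_image_smul (w : W n) (s : Set (H n)) :
    leb n ((fun x => w • x) '' s) = leb n s := by
  have h := Measure.addHaar_image_linearMap (leb n)
    ((permIsometry w).toLinearEquiv : H n →ₗ[ℝ] H n)
  have hball := h (Metric.ball 0 1)
  have himage : (((permIsometry w).toLinearEquiv : H n →ₗ[ℝ] H n) : H n → H n) ''
      Metric.ball 0 1 = Metric.ball 0 1 := by
    have := (permIsometry w).image_ball 0 1
    rwa [map_zero] at this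
  rw [himage] at hball
  have hdet := (ENNReal.mul_eq_right (Metric.measure_ball_pos _ _ one_pos).ne'
    measure_ball_lt_top.ne).1 hball.symm
  have hs := h s
  rw [hdet, one_mul] at hs
  exact hs

theorem isCompact_F : IsCompact (F n) :=
  ((Set.finite_range (weight n)).insert 0).isCompact_convexHull ℝ

theorem isCompact_Ftilde : IsCompact (Ftilde n) :=
  isCompact_iUnion fun w => isCompact_F.image (permIsometry w).continuous

/-- The hyperplanes orthogonal to the roots are null sets. -/
theorem leb_setOf_sub_eq {i j : Fin (n + 1)} (hij : i ≠ j) (c : ℝ) :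
    leb n {x | x.1 i - x.1 j = c} = 0 := by
  let A : AffineSubspace ℝ (H n) :=
    { carrier := {x | x.1 i - x.1 j = c}
      smul_vsub_vadd_mem' := by
        intro r x y z hx hy hz
        simp only [Set.mem_ofPred_eq, vsub_eq_sub, vadd_eq_add, coord_add, coord_smul,
          coord_sub] at *
        linear_combination r * hx - r * hy + hz }
  refine Measure.addHaar_affineSubspace (leb n) A fun hA => ?_
  have hmem : ∀ x : H n, x.1 i - x.1 j = c := fun x => by
    have : x ∈ A := hA ▸ AffineSubspace.mem_top ℝ (H n) x
    exact this
  -- The functional takes the value `2` at this root and `0` at the origin, so it is not constant.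
  let y : H n := ⟨EuclideanSpace.single i 1 - EuclideanSpace.single j 1, by
    change ∑ k, _ = (0 : ℝ)
    simp [Finset.sum_sub_distrib]⟩
  have h0 := hmem 0
  have h1 := hmem y
  simp [y, hij, hij.symm] at h0 h1
  linarith

/-- A point with distinct coordinates is put in decreasing order by only one permutation, so
overlaps lie on root hyperplanes. -/
theorem aedisjoint_image_smul_F {v w : W n} (hvw : v ≠ w) :
    AEDisjoint (leb n) ((fun x => v • x) '' F n) ((fun x => w • x) '' F n) := by
  have hnull : leb n (⋃ (i : Fin (n + 1)) (j : Fin (n + 1)) (_ : i ≠ j),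
      {x | x.1 i - x.1 j = 0}) = 0 := by
    simp only [measure_iUnion_null_iff]
    exact fun i j hij => leb_setOf_sub_eq hij 0
  refine measure_mono_null ?_ hnull
  rintro _ ⟨⟨y, hy, rfl⟩, z, hz, hzy⟩
  by_contra hx
  simp only [Set.mem_iUnion, Set.mem_ofPred_eq, not_exists] at hx
  have hinj : Function.Injective fun i => (v • y).1 i := fun i j hij => by
    by_contra hne
    exact hx i j hne (sub_eq_zero.2 hij)
  have h1 : Antitone ((fun i => (v • y).1 i) ∘ v) := by
    convert ((mem_F_iff y).1 hy).1 using 2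
    simp [smul_apply]
  have h2 : Antitone ((fun i => (v • y).1 i) ∘ w) := by
    convert ((mem_F_iff z).1 hz).1 using 2
    simp [← hzy, smul_apply]
  have h3 := Tuple.unique_antitone h1 h2
  exact hvw (Equiv.ext fun i => hinj (congrFun h3 i))

theorem leb_real_Ftilde :
    (leb n).real (Ftilde n) = Fintype.card (W n) * (leb n).real (F n) := by
  have h : leb n (Ftilde n) = Fintype.card (W n) * leb n (F n) := by
    rw [Ftilde, measure_iUnion₀ (fun v w hvw => aedisjoint_image_smul_F hvw)
      fun w => (isCompact_F.image (permIsometry w).continuous).measurableSet.nullMeasurableSet]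
    simp [leb_image_smul]
  simp [measureReal_def, h]

end Geometry

end WeylA

namespace WeylA

/-! ### The root lattice and its periodic exponentials -/

section Lattice

open MeasureTheory
open scoped Pointwise

variable {n : ℕ}

/-- The root lattice of `Aₙ`: the points of `H n` with integer coordinates. -/
def rootLattice (n : ℕ) : AddSubgroup (H n) where
  carrier := {x | ∀ i, ∃ m : ℤ, x.1 i = m}
  zero_mem' i := ⟨0, by simp⟩
  add_mem' {x y} hx hy i := by
    obtain ⟨a, ha⟩ := hx i
    obtain ⟨b, hb⟩ := hy i
    exact ⟨a + b, by rw [coord_add, ha, hb]; push_cast; rfl⟩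
  neg_mem' {x} hx i := by
    obtain ⟨a, ha⟩ := hx i
    exact ⟨-a, by rw [coord_neg, ha]; push_cast; rfl⟩

instance : Countable (rootLattice n) := by
  choose m hm using fun x : rootLattice n => x.2
  refine Function.Injective.countable (f := m) fun x y hxy => Subtype.ext (H_ext fun i => ?_)
  rw [hm, hm, hxy]

/-- Every point of `H n` can be moved into `Ftilde n` by the root lattice. -/
theorem exists_add_mem_Ftilde (x : H n) : ∃ q ∈ rootLattice n, q + x ∈ Ftilde n := by
  set y : Fin (n + 1) → ℝ := fun i => Int.fract (x.1 i) with hy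
  set σ : W n := Tuple.sort y
  have hmono : Monotone (y ∘ σ) := Tuple.monotone_sort y
  -- the fractional parts add up to the integer `m`
  set m : ℤ := -∑ i, ⌊x.1 i⌋ with hm
  have hsum : ∑ i, y i = m := by
    simp only [hy, Int.fract, Finset.sum_sub_distrib, sum_coord, hm]
    push_cast
    ring
  have hm0 : 0 ≤ m := by
    have : (0 : ℝ) ≤ m := hsum ▸ Finset.sum_nonneg fun i _ => Int.fract_nonneg _
    exact_mod_cast this
  have hmn : m ≤ n + 1 := by
    have : (m : ℝ) ≤ n + 1 := by
      rw [← hsum]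
      calc ∑ i, y i ≤ ∑ _i : Fin (n + 1), (1 : ℝ) :=
            Finset.sum_le_sum fun i _ => (Int.fract_lt_one _).le
        _ = n + 1 := by simp
    exact_mod_cast this
  obtain ⟨k, hk⟩ := Int.eq_ofNat_of_zero_le hm0
  have hkn : k ≤ n + 1 := by omega
  -- subtract `1` from the `k` largest fractional parts
  set e : Fin (n + 1) → ℤ := fun i => if n + 1 - k ≤ (σ⁻¹ i).val then 1 else 0 with he
  have hesum : ∑ i, e i = k := by
    have h1 : ∑ i, e i = ∑ i : Fin (n + 1), if n + 1 - k ≤ i.val then (1 : ℤ) else 0 :=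
      Equiv.sum_comp σ⁻¹ fun i : Fin (n + 1) => if n + 1 - k ≤ i.val then (1 : ℤ) else 0
    rw [h1, Fin.sum_univ_eq_sum_range (fun i => if n + 1 - k ≤ i then (1 : ℤ) else 0) (n + 1),
      Finset.sum_boole]
    have h2 : (Finset.range (n + 1)).filter (fun i => n + 1 - k ≤ i) =
        Finset.Ico (n + 1 - k) (n + 1) := by
      ext i
      simp only [Finset.mem_filter, Finset.mem_range, Finset.mem_Ico]
      tauto
    rw [h2, Nat.card_Ico]
    simp
    omega
  let q : H n := ⟨WithLp.toLp 2 fun i => ((-⌊x.1 i⌋ - e i : ℤ) : ℝ), by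
    change ∑ i, ((-⌊x.1 i⌋ - e i : ℤ) : ℝ) = 0
    rw [← Int.cast_sum, Finset.sum_sub_distrib, hesum, Finset.sum_neg_distrib, ← hm, hk]
    simp⟩
  refine ⟨q, fun i => ⟨_, rfl⟩, (mem_Ftilde_iff _).2 fun i j => ?_⟩
  have hq : ∀ i, (q + x).1 i = y i - e i := fun i => by
    rw [coord_add]
    change ((-⌊x.1 i⌋ - e i : ℤ) : ℝ) + x.1 i = Int.fract (x.1 i) - e i
    rw [Int.fract]
    push_cast
    ring
  rw [hq, hq]
  have hi0 : 0 ≤ y i := Int.fract_nonneg _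
  have hi1 : y i < 1 := Int.fract_lt_one _
  have hj0 : 0 ≤ y j := Int.fract_nonneg _
  have hj1 : y j < 1 := Int.fract_lt_one _
  simp only [he]
  split_ifs with h1 h2 h2
  · linarith
  · push_cast
    linarith
  -- Only `j` was lowered, so `y i ≤ y j`: this is where choosing the largest fractional parts
  -- matters.
  · have hle : σ⁻¹ i ≤ σ⁻¹ j := by
      rw [Fin.le_def]; omega
    have := hmono hle
    simp only [Function.comp_apply, Equiv.Perm.coe_inv, Equiv.apply_symm_apply] at this
    push_cast
    linarith
  · push_cast
    linarith

/-- The integer coordinates of `q` sum to zero, so some `m i ≥ 1` and some `m j ≤ -1`. Translation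
by `q` then raises the difference of coordinates `i` and `j` by at least `2`, the full width of
`[-1, 1]`, so overlaps lie on a hyperplane. -/
theorem aedisjoint_vadd_Ftilde (q : rootLattice n) (hq : q ≠ 0) :
    AEDisjoint (leb n) (q +ᵥ Ftilde n) (Ftilde n) := by
  choose m hm using q.2
  have hsum : ∑ i, m i = 0 := by
    have := sum_coord q.1
    simp only [hm] at this
    exact_mod_cast this
  have hne : ∃ i, m i ≠ 0 := by
    by_contra! h
    exact hq (Subtype.ext (H_ext fun i => by rw [hm, h]; simp))
  obtain ⟨i, hi⟩ : ∃ i, 0 < m i := by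
    by_contra! h
    obtain ⟨k, hk⟩ := hne
    exact hk ((Finset.sum_eq_zero_iff_of_nonpos fun i _ => h i).1 hsum k (Finset.mem_univ k))
  obtain ⟨j, hj⟩ : ∃ j, m j < 0 := by
    by_contra! h
    obtain ⟨k, hk⟩ := hne
    exact hk ((Finset.sum_eq_zero_iff_of_nonneg fun i _ => h i).1 hsum k (Finset.mem_univ k))
  have hij : i ≠ j := by rintro rfl; omega
  refine measure_mono_null ?_ (leb_setOf_sub_eq hij 1)
  rintro _ ⟨⟨x, hx, rfl⟩, hx'⟩
  have h1 := (mem_Ftilde_iff _).1 hx j i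
  have h2 := (mem_Ftilde_iff _).1 hx' i j
  have h3 : ∀ k, ((fun x => q +ᵥ x) x : H n).1 k = m k + x.1 k := fun k => by
    rw [← hm]; rfl
  have h4 : (1 : ℝ) ≤ m i := by exact_mod_cast hi
  have h5 : (m j : ℝ) ≤ -1 := by exact_mod_cast (show m j ≤ -1 by omega)
  rw [Set.mem_ofPred_eq]
  rw [h3, h3] at h2 ⊢
  linarith

theorem isAddFundamentalDomain_Ftilde :
    IsAddFundamentalDomain (rootLattice n) (Ftilde n) (leb n) := by
  refine IsAddFundamentalDomain.mk'' isCompact_Ftilde.measurableSet.nullMeasurableSet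
    (Filter.Eventually.of_forall fun x => ?_) aedisjoint_vadd_Ftilde
    fun q => (measurePreserving_vadd q (leb n)).quasiMeasurePreserving
  obtain ⟨q, hq, hx⟩ := exists_add_mem_Ftilde x
  exact ⟨⟨q, hq⟩, hx⟩

/-- The exponential function attached to a point of `H n`. -/
noncomputable def expInner (p x : H n) : ℂ :=
  Complex.exp (2 * Real.pi * Complex.I * ((inner ℝ p x : ℝ) : ℂ))

theorem continuous_expInner (p : H n) : Continuous (expInner p) := by
  unfold expInner
  fun_prop

theorem expInner_add_right (p x y : H n) : expInner p (x + y) = expInner p x * expInner p y := by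
  simp only [expInner, ← Complex.exp_add, inner_add_right]
  push_cast
  ring_nf

theorem expInner_mul_conj (p q x : H n) :
    expInner p x * (starRingEnd ℂ) (expInner q x) = expInner (p - q) x := by
  simp only [expInner, ← Complex.exp_conj, ← Complex.exp_add, inner_sub_left]
  simp only [map_mul, Complex.conj_ofReal, Complex.conj_I, map_ofNat]
  push_cast
  ring_nf

/-- Points of `H n` in the weight lattice, that is, with integral inner products with all roots. -/
def IsWeight (p : H n) : Prop := ∀ i j, ∃ m : ℤ, p.1 i - p.1 j = m

theorem IsWeight.sub {p q : H n} (hp : IsWeight p) (hq : IsWeight q) : IsWeight (p - q) := by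
  intro i j
  obtain ⟨a, ha⟩ := hp i j
  obtain ⟨b, hb⟩ := hq i j
  refine ⟨a - b, ?_⟩
  rw [coord_sub, coord_sub]
  push_cast
  linarith

theorem IsWeight.smul {p : H n} (hp : IsWeight p) (w : W n) : IsWeight (w • p) :=
  fun i j => hp (w⁻¹ i) (w⁻¹ j)

theorem IsWeight.expInner_eq_one {p : H n} (hp : IsWeight p) {q : H n} (hq : q ∈ rootLattice n) :
    expInner p q = 1 := by
  choose a ha using fun i => hp i 0
  choose b hb using hq
  have h : inner ℝ p q = ((∑ i, a i * b i : ℤ) : ℝ) := by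
    -- The coordinates of `q` sum to zero, so those of `p` may be shifted to become integers.
    have h1 : ∑ i, p.1 i * q.1 i = ∑ i, (p.1 i - p.1 0) * q.1 i := by
      simp only [sub_mul, Finset.sum_sub_distrib, ← Finset.mul_sum, sum_coord, mul_zero, sub_zero]
    rw [inner_eq_sum, h1]
    simp only [ha, hb]
    push_cast
    rfl
  rw [expInner, h, Complex.exp_eq_one_iff]
  exact ⟨∑ i, a i * b i, by push_cast; ring⟩

/-- Orthogonality of the exponentials of the weight lattice on `Ftilde n`. -/
theorem IsWeight.setIntegral_expInner {p : H n} (hp : IsWeight p) (hp0 : p ≠ 0) :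
    ∫ x in Ftilde n, expInner p x ∂leb n = 0 := by
  have hpos : (0 : ℝ) < inner ℝ p p := real_inner_self_pos.2 hp0
  -- Chosen so that `⟨p, t⟩ = 1/2`: translation by `t` negates the exponential, while the translated
  -- domain is again fundamental. The integral therefore equals its own negative.
  set t : H n := (1 / (2 * inner ℝ p p) : ℝ) • p with ht
  have hexp : expInner p t = -1 := by
    have : inner ℝ p t = (1 / 2 : ℝ) := by
      refine (real_inner_smul_right p p _).trans ?_
      field_simp
    rw [expInner, this, ← Complex.exp_pi_mul_I]
    push_cast
    ring_nf
  have hfund := isAddFundamentalDomain_Ftilde (n := n)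
  have h1 : ∫ x in Ftilde n, expInner p x ∂leb n =
      ∫ x in t +ᵥ Ftilde n, expInner p x ∂leb n := by
    refine hfund.setIntegral_eq (hfund.vadd_of_comm t) fun q x => ?_
    change expInner p (q.1 + x) = _
    rw [expInner_add_right, hp.expInner_eq_one q.2, one_mul]
  have h2 : ∫ x in t +ᵥ Ftilde n, expInner p x ∂leb n =
      ∫ x in Ftilde n, expInner p (t + x) ∂leb n :=
    (measurePreserving_vadd t (leb n)).setIntegral_image_emb
      (measurableEmbedding_const_vadd t) _ _
  simp only [expInner_add_right, hexp, integral_const_mul] at h2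
  rw [h2] at h1
  linear_combination h1 / 2

end Lattice

end WeylA

namespace WeylA

/-! ### Dominant weights and orthogonality of immanants -/

section Orthogonality

open MeasureTheory

variable {n : ℕ}

theorem sub_succ_sum_nsmul_weight (c : Fin n → ℕ) (i : Fin n) :
    (∑ j, c j • weight n j).1 i.castSucc - (∑ j, c j • weight n j).1 i.succ = c i := by
  simp only [← Nat.cast_smul_eq_nsmul ℝ]
  exact sub_succ_sum_smul_weight (fun j => (c j : ℝ)) i

theorem antitone_of_mem_dominant {p : H n} (hp : p ∈ dominant n) : Antitone fun i => p.1 i := by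
  obtain ⟨c, rfl⟩ := hp
  refine Fin.antitone_iff_succ_le.2 fun i => ?_
  have := sub_succ_sum_nsmul_weight c i
  have h0 : (0 : ℝ) ≤ c i := Nat.cast_nonneg _
  linarith

theorem strictAnti_of_mem_strictlyDominant {p : H n} (hp : p ∈ strictlyDominant n) :
    StrictAnti fun i => p.1 i := by
  obtain ⟨c, hc, rfl⟩ := hp
  refine Fin.strictAnti_iff_succ_lt.2 fun i => ?_
  have := sub_succ_sum_nsmul_weight c i
  have h0 : (0 : ℝ) < c i := Nat.cast_pos.2 (hc i)
  linarith

theorem isWeight_of_mem_dominant {p : H n} (hp : p ∈ dominant n) : IsWeight p := by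
  obtain ⟨c, rfl⟩ := hp
  set p := ∑ i, c i • weight n i with hp
  have h : ∀ i, ∃ m : ℤ, p.1 i - p.1 0 = m := by
    intro i
    induction i using Fin.induction with
    | zero => exact ⟨0, by simp⟩
    | succ i ih =>
      obtain ⟨m, hm⟩ := ih
      refine ⟨m - c i, ?_⟩
      have := sub_succ_sum_nsmul_weight c i
      rw [← hp] at this
      push_cast
      linarith
  intro i j
  obtain ⟨a, ha⟩ := h i
  obtain ⟨b, hb⟩ := h j
  exact ⟨a - b, by push_cast; linarith⟩

theorem strictlyDominant_subset_dominant : strictlyDominant n ⊆ dominant n :=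
  fun _ ⟨c, _, h⟩ => ⟨c, h⟩

/-- Every orbit of the Weyl group contains at most one dominant weight. -/
theorem eq_of_smul_eq_smul {p q : H n} (hp : p ∈ dominant n) (hq : q ∈ dominant n) {v w : W n}
    (h : w • p = v • q) : p = q := by
  -- Both `w` and `v` sort the same vector decreasingly, and the sorted vector is unique.
  have h1 : Antitone ((fun i => (w • p).1 i) ∘ w) := by
    convert antitone_of_mem_dominant hp using 2
    simp [smul_apply]
  have h2 : Antitone ((fun i => (w • p).1 i) ∘ v) := by
    convert antitone_of_mem_dominant hq using 2
    simp [h, smul_apply]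
  refine H_ext fun i => ?_
  have h3 := congrFun (Tuple.unique_antitone h1 h2) i
  simp only [Function.comp_apply] at h3
  rw [smul_apply, Equiv.Perm.coe_inv, Equiv.symm_apply_apply, h, smul_apply, Equiv.Perm.coe_inv, Equiv.symm_apply_apply] at h3
  exact h3

theorem stab_eq_of_mem_strictlyDominant {p : H n} (hp : p ∈ strictlyDominant n) :
    stab p = {1} := by
  ext w
  simp only [stab, Finset.mem_filter, Finset.mem_univ, true_and, Finset.mem_singleton]
  refine ⟨fun h => ?_, fun h => by rw [h, one_smul]⟩
  refine inv_eq_one.1 (Equiv.ext fun i => ?_)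
  exact (strictAnti_of_mem_strictlyDominant hp).injective (congrArg (fun x : H n => x.1 i) h)

theorem Imm_eq_sum (χ : W n → ℂ) (p x : H n) : Imm χ p x = ∑ w, χ w * expInner (w • p) x := rfl

theorem Imm_mul_conj_Imm (χ ψ : W n → ℂ) (p q x : H n) :
    Imm χ p x * (starRingEnd ℂ) (Imm ψ q x) =
      ∑ w, ∑ v, χ w * (starRingEnd ℂ) (ψ v) * expInner (w • p - v • q) x := by
  rw [Imm_eq_sum, Imm_eq_sum, map_sum, Finset.sum_mul_sum]
  refine Finset.sum_congr rfl fun w _ => Finset.sum_congr rfl fun v _ => ?_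
  rw [map_mul, ← expInner_mul_conj]
  ring

open Classical in
theorem setIntegral_Imm_mul_conj_Imm (χ ψ : W n → ℂ) {p q : H n} (hp : IsWeight p)
    (hq : IsWeight q) :
    ∫ x in Ftilde n, Imm χ p x * (starRingEnd ℂ) (Imm ψ q x) ∂leb n =
      (leb n).real (Ftilde n) *
        ∑ v, ∑ w, if w • p = v • q then χ w * (starRingEnd ℂ) (ψ v) else 0 := by
  have hint : ∀ r : H n, IntegrableOn (expInner r) (Ftilde n) (leb n) := fun r =>
    (continuous_expInner r).continuousOn.integrableOn_compact isCompact_Ftilde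
  have hexp : ∀ w v : W n, ∫ x in Ftilde n, expInner (w • p - v • q) x ∂leb n =
      if w • p = v • q then ((leb n).real (Ftilde n) : ℂ) else 0 := by
    intro w v
    split_ifs with h
    · simp [h, expInner]
    · exact ((hp.smul w).sub (hq.smul v)).setIntegral_expInner (sub_ne_zero.2 h)
  simp only [Imm_mul_conj_Imm]
  rw [integral_finsetSum _ fun w _ => integrable_finsetSum _ fun v _ => (hint _).const_mul _,
    Finset.sum_comm, Finset.mul_sum]
  refine Finset.sum_congr rfl fun w _ => ?_
  rw [integral_finsetSum _ fun v _ => (hint _).const_mul _, Finset.mul_sum]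
  refine Finset.sum_congr rfl fun v _ => ?_
  rw [integral_const_mul, hexp]
  split_ifs <;> ring

open Classical in
theorem setIntegral_Imm_mul_conj_Imm_of_isIrredChar {χ ψ : W n → ℂ} (hχ : IsIrredChar χ)
    (hψ : IsIrredChar ψ) {p q : H n} (hp : p ∈ dominant n) (hq : q ∈ dominant n) :
    ∫ x in Ftilde n, Imm χ p x * (starRingEnd ℂ) (Imm ψ q x) ∂leb n =
      (Fintype.card (W n) : ℂ) ^ 2 * ((leb n).real (F n) : ℂ) * delta p q * delta χ ψ *
        (1 / χ 1) * ∑ w ∈ stab p, χ w := by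
  rw [setIntegral_Imm_mul_conj_Imm χ ψ (isWeight_of_mem_dominant hp) (isWeight_of_mem_dominant hq),
    leb_real_Ftilde]
  by_cases hpq : p = q
  · subst hpq
    -- Substituting `w = v * s` turns the condition into `s ∈ stab p`.
    have hsum : (∑ v : W n, ∑ w : W n,
        if w • p = v • p then χ w * (starRingEnd ℂ) (ψ v) else 0) =
        ∑ s ∈ stab p, ∑ v, χ (v * s) * (starRingEnd ℂ) (ψ v) := by
      rw [Finset.sum_comm (s := stab p)]
      refine Finset.sum_congr rfl fun v _ => ?_
      rw [stab, Finset.sum_filter]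
      refine (Fintype.sum_equiv (Equiv.mulLeft v) _ _ fun s => ?_).symm
      simp [mul_smul]
    rw [hsum, Finset.sum_congr rfl fun s _ => hχ.sum_mul_conj hψ s, ← Finset.mul_sum]
    simp only [delta, if_true]
    push_cast
    ring
  · have hsum : (∑ v : W n, ∑ w : W n,
        if w • p = v • q then χ w * (starRingEnd ℂ) (ψ v) else 0) = 0 :=
      Finset.sum_eq_zero fun v _ => Finset.sum_eq_zero fun w _ =>
        if_neg fun h => hpq (eq_of_smul_eq_smul hp hq h)
    simp [hsum, delta, hpq]

end Orthogonality

end WeylA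

theorem theorem1 (n : ℕ) (hn : 1 ≤ n) (χ ψ : WeylA.W n → ℂ)
    (hχ : WeylA.IsIrredChar χ) (hψ : WeylA.IsIrredChar ψ) :
    (∀ lam ∈ WeylA.dominant n, ∀ mu ∈ WeylA.dominant n, lam ≠ 0 → mu ≠ 0 →
      ∫ x in WeylA.Ftilde n, WeylA.Imm χ lam x * (starRingEnd ℂ) (WeylA.Imm ψ mu x)
          ∂(WeylA.leb n) =
        (Fintype.card (WeylA.W n) : ℂ) ^ 2 * ((WeylA.leb n).real (WeylA.F n) : ℂ) *
          WeylA.delta lam mu * WeylA.delta χ ψ * (1 / χ 1) * ∑ w ∈ WeylA.stab lam, χ w) ∧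
    (∀ lam ∈ WeylA.strictlyDominant n, ∀ mu ∈ WeylA.strictlyDominant n,
      ∫ x in WeylA.Ftilde n, WeylA.Imm χ lam x * (starRingEnd ℂ) (WeylA.Imm ψ mu x)
          ∂(WeylA.leb n) =
        ((WeylA.leb n).real (WeylA.F n) : ℂ) * (Fintype.card (WeylA.W n) : ℂ) ^ 2 *
          WeylA.delta χ ψ * WeylA.delta lam mu) := by
  refine ⟨fun lam hlam mu hmu _ _ =>
    WeylA.setIntegral_Imm_mul_conj_Imm_of_isIrredChar hχ hψ hlam hmu, fun lam hlam mu hmu => ?_⟩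
  -- With trivial stabilizer the last sum is `χ 1`, which cancels the factor `1 / χ 1`.
  have hd : χ 1 ≠ 0 := hχ.apply_one_ne_zero
  rw [WeylA.setIntegral_Imm_mul_conj_Imm_of_isIrredChar hχ hψ
    (WeylA.strictlyDominant_subset_dominant hlam) (WeylA.strictlyDominant_subset_dominant hmu),
    WeylA.stab_eq_of_mem_strictlyDominant hlam, Finset.sum_singleton]
  field_simp
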